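/- Let $p$ be a prime number, let $L$ be a finite extension of $\mathbb{Q}_p$, endowed with the absolute value extending the $p$-adic one (normalized by $|p|=p^{-1}$), and let $A$ be a Fréchet algebra over $L$: an associative unital $L$-algebra endowed with a topology that is Hausdorff and complete, is defined by a countable family of nonarchimedean seminorms on the $L$-vector space $A$, and makes the multiplication $A\times A\to A$ continuous. If $A$ is a division algebra and every element of $A$ is algebraic over $L$, then $A$ is finite-dimensional over $L$. -/

import Mathlib

/-- A Fréchet space over a nonarchimedean field `K`: a `K`-vector space which is Hausdorff and
complete for a topology defined by a countable family of nonarchimedean seminorms (equivalently: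
locally convex, metrizable and complete). The uniform structure is that of the additive group,
so it carries no more information than the topology. -/
structure IsFrechetSpace (K E : Type*) [NormedField K] [AddCommGroup E] [Module K E]
    [UniformSpace E] : Prop where
  isUniformAddGroup : IsUniformAddGroup E
  t2Space : T2Space E
  completeSpace : CompleteSpace E
  exists_seminorms : ∃ q : ℕ → Seminorm K E,
    (∀ n, IsNonarchimedean (q n)) ∧ WithSeminorms q

/-- A Fréchet algebra over `K`: an associative unital `K`-algebra whose underlying space is a
Fréchet space and whose multiplication is (jointly) continuous. The seminorms are not required
to be submultiplicative. -/
structure IsFrechetAlgebra (K A : Type*) [NormedField K] [Ring A] [Algebra K A]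
    [UniformSpace A] : Prop extends IsFrechetSpace K A where
  continuousMul : ContinuousMul A

/-!
Let `D` be the division algebra, over a complete field `K`. Its elements of degree less than `n`
form a closed set, because `1, a, …, a ^ (n - 1)` are linearly independent on an open set of `a`. By
Baire, one of these sets has an interior point `a`. Every line through `a` then meets it in
infinitely many points; but along a line the independence of the first `n` powers is witnessed by a
determinant polynomial in the parameter, so it fails either everywhere or at finitely many points.
Hence all degrees are less than `n`.

Let `x` have maximal degree. By the primitive element theorem a commutative subalgebra containing
`x` cannot be larger than `S = K[x]`, so `S` is its own centralizer. Vectors `v j` independent over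
the centralizer of `S` give maps `s ↦ s * v j` from `S` to `D` which are independent over `D`, so
`D` has dimension at most `dim_K S` over `S`.
-/

open Filter Module Polynomial Topology

section LinearIndependent

theorem linearIndependent_iff_forall_norm_eq_one {K E ι : Type*} [NormedField K] [AddCommGroup E]
    [Module K E] [Fintype ι] {v : ι → E} :
    LinearIndependent K v ↔ ∀ c : ι → K, ‖c‖ = 1 → ∑ i, c i • v i ≠ 0 := by
  rw [Fintype.linearIndependent_iff]
  refine ⟨fun h c hc hsum => ?_, fun h c hsum => ?_⟩
  · have : c = 0 := funext (h c hsum)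
    simp [this] at hc
  · by_contra! hc
    obtain ⟨i, hi⟩ := hc
    obtain ⟨j, -, hj⟩ := Finset.univ.exists_max_image (fun j => ‖c j‖) ⟨i, Finset.mem_univ i⟩
    have hcj : c j ≠ 0 := norm_pos_iff.1 ((norm_pos_iff.2 hi).trans_le (hj i (Finset.mem_univ i)))
    have hnorm : ‖c‖ = ‖c j‖ := le_antisymm
      ((pi_norm_le_iff_of_nonneg (norm_nonneg _)).2 fun k => hj k (Finset.mem_univ k))
      (norm_le_pi_norm c j)
    refine h ((c j)⁻¹ • c) ?_ ?_
    · rw [norm_smul, norm_inv, hnorm, inv_mul_cancel₀ (norm_ne_zero_iff.2 hcj)]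
    · simp only [Pi.smul_apply, smul_assoc, ← Finset.smul_sum, hsum, smul_zero]

theorem isOpen_setOfPred_linearIndependent_of_t2Space {K E ι : Type*} [NontriviallyNormedField K]
    [CompleteSpace K] [AddCommGroup E] [Module K E] [TopologicalSpace E] [T2Space E]
    [IsTopologicalAddGroup E] [ContinuousSMul K E] [Finite ι] :
    IsOpen {v : ι → E | LinearIndependent K v} := by
  have := Fintype.ofFinite ι
  refine isOpen_iff_eventually.2 fun v (hv : LinearIndependent K v) => ?_
  set S := Fintype.linearCombination K v '' Metric.sphere 0 1
  have hS : IsClosed S := (LinearMap.isClosedEmbedding_of_injective <| LinearMap.ker_eq_bot.2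
    hv.fintypeLinearCombination_injective).isClosedMap _ Metric.isClosed_sphere
  have h0S : (0 : E) ∉ S := by
    rintro ⟨c, hc, hsum⟩
    exact linearIndependent_iff_forall_norm_eq_one.1 hv c (mem_sphere_zero_iff_norm.1 hc) hsum
  have hcont : Continuous fun x : (ι → K) × (ι → E) => ∑ i, x.1 i • x.2 i := by fun_prop
  have hsmall : ∀ᶠ x in 𝓝 (0 : ι → K) ×ˢ 𝓝 (0 : ι → E), ∑ i, x.1 i • x.2 i ∉ S := by
    rw [← nhds_prod_eq]
    exact hcont.tendsto' 0 0 (by simp) |>.eventually (hS.isOpen_compl.eventually_mem h0S)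
  obtain ⟨P, hP, Q, hQ, hPQ⟩ := eventually_prod_iff.1 hsmall
  obtain ⟨ε, hε, hPε⟩ := Metric.eventually_nhds_iff.1 hP
  obtain ⟨a, ha, haε⟩ := NormedField.exists_norm_lt K hε
  -- `hPQ` only controls small coefficients, so a relation among the `w i` with coefficients `c` of
  -- norm one is rewritten using `c i • (v i - w i) = (a • c i) • a⁻¹ • (v i - w i)`.
  have hscale : Continuous fun w : ι → E => a⁻¹ • (v - w) := by fun_prop
  have hQv : ∀ᶠ w in 𝓝 v, Q (a⁻¹ • (v - w)) :=
    hscale.tendsto' v 0 (by simp) |>.eventually hQ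
  filter_upwards [hQv] with w hw
  refine linearIndependent_iff_forall_norm_eq_one.2 fun c hc hsum => ?_
  have hac : P (a • c) := hPε (by simpa [norm_smul, hc] using haε)
  refine hPQ hac hw ⟨c, mem_sphere_zero_iff_norm.2 hc, ?_⟩
  rw [Fintype.linearCombination_apply]
  calc ∑ i, c i • v i = ∑ i, c i • (v i - w i) := by
        simp only [smul_sub, Finset.sum_sub_distrib, hsum, sub_zero]
    _ = ∑ i, (a • c) i • (a⁻¹ • (v - w)) i := Finset.sum_congr rfl fun i _ => by
        rw [Pi.smul_apply, Pi.smul_apply, smul_eq_mul, smul_smul, mul_right_comm,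
          mul_inv_cancel₀ (norm_pos_iff.1 ha), one_mul, Pi.sub_apply]

theorem finite_setOfPred_not_linearIndependent_of_forall_exists_polynomial {K V ι : Type*} [Field K]
    [AddCommGroup V] [Module K V] [Finite ι] {v : K → ι → V}
    (hv : ∀ i (φ : V →ₗ[K] K), ∃ P : K[X], ∀ t, P.eval t = φ (v t i)) {t₀ : K}
    (h₀ : LinearIndependent K (v t₀)) : {t | ¬ LinearIndependent K (v t)}.Finite := by
  classical
  have := Fintype.ofFinite ι
  obtain ⟨g, hg⟩ := LinearMap.exists_leftInverse_of_injective
    (Fintype.linearCombination K (v t₀))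
    (LinearMap.ker_eq_bot.2 h₀.fintypeLinearCombination_injective)
  choose P hP using fun i j => hv i (LinearMap.proj j ∘ₗ g)
  have hdet (t : K) : (Matrix.of P).det.eval t = (Matrix.of fun i => g (v t i)).det := by
    rw [← coe_evalRingHom, RingHom.map_det]
    congr 1
    ext i j
    simp [hP]
  have hgv (i : ι) : g (v t₀ i) = Pi.single i 1 := by
    simpa using LinearMap.congr_fun hg (Pi.single i 1)
  have hone : (Matrix.of fun i => g (v t₀ i)) = 1 := by
    ext i j
    simp [hgv, Matrix.one_apply, Pi.single_apply, eq_comm]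
  have hne : (Matrix.of P).det ≠ 0 := by
    intro h
    simpa [h, hone] using hdet t₀
  refine (finite_setOfPred_isRoot hne).subset fun t ht => ?_
  by_contra hroot
  have hunit : IsUnit (Matrix.of fun i => g (v t i)) := by
    rw [Matrix.isUnit_iff_isUnit_det, ← hdet]
    exact IsUnit.mk0 _ hroot
  exact ht (Matrix.linearIndependent_rows_of_isUnit hunit).of_comp

end LinearIndependent

section Degree

theorem linearIndependent_fin_pow_iff {K A : Type*} [Field K] [Ring A] [Algebra K A] {a : A}
    (ha : IsIntegral K a) {n : ℕ} :
    LinearIndependent K (fun i : Fin n => a ^ (i : ℕ)) ↔ n ≤ (minpoly K a).natDegree := by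
  refine ⟨fun h => ?_, fun h =>
    (linearIndependent_pow (K := K) a).comp (Fin.castLE h) (Fin.castLE_injective h)⟩
  by_contra! hlt
  refine Fintype.not_linearIndependent_iff.2
    ⟨fun i : Fin n => (minpoly K a).coeff i, ?_, ⟨_, hlt⟩, ?_⟩ h
  · rw [Fin.sum_univ_eq_sum_range fun i => (minpoly K a).coeff i • a ^ i,
      ← aeval_eq_sum_range' hlt, minpoly.aeval]
  · simp [minpoly.ne_zero ha]

theorem exists_polynomial_eval_eq_apply_add_smul_pow {K A : Type*} [CommRing K] [Ring A]
    [Algebra K A] (a b : A) (i : ℕ) (φ : A →ₗ[K] K) :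
    ∃ P : K[X], ∀ t : K, P.eval t = φ ((a + t • b) ^ i) := by
  induction i generalizing φ with
  | zero => exact ⟨C (φ 1), fun t => by simp⟩
  | succ i ih =>
    obtain ⟨P, hP⟩ := ih (φ ∘ₗ LinearMap.mulRight K a)
    obtain ⟨Q, hQ⟩ := ih (φ ∘ₗ LinearMap.mulRight K b)
    exact ⟨P + X * Q, fun t => by simp [hP, hQ, pow_succ, mul_add]⟩

theorem finite_setOfPred_natDegree_minpoly_add_smul_lt {K A : Type*} [Field K] [Ring A]
    [Algebra K A] [Algebra.IsIntegral K A] (a b : A) {n : ℕ} {t₀ : K}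
    (h₀ : n ≤ (minpoly K (a + t₀ • b)).natDegree) :
    {t : K | (minpoly K (a + t • b)).natDegree < n}.Finite := by
  simp only [← not_le, ← linearIndependent_fin_pow_iff (Algebra.IsIntegral.isIntegral _)] at h₀ ⊢
  exact finite_setOfPred_not_linearIndependent_of_forall_exists_polynomial
    (v := fun t (i : Fin n) => (a + t • b) ^ (i : ℕ))
    (fun i => exists_polynomial_eval_eq_apply_add_smul_pow a b i) h₀

theorem natDegree_minpoly_lt_of_nonempty_interior {K A : Type*} [NontriviallyNormedField K]
    [Ring A] [Algebra K A] [Algebra.IsIntegral K A] [TopologicalSpace A] [ContinuousAdd A]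
    [ContinuousSMul K A] {n : ℕ} (h : (interior {a : A | (minpoly K a).natDegree < n}).Nonempty)
    (b : A) : (minpoly K b).natDegree < n := by
  obtain ⟨a, ha⟩ := h
  by_contra! hb
  have hfinite : {t : K | (minpoly K (a + t • (b - a))).natDegree < n}.Finite :=
    finite_setOfPred_natDegree_minpoly_add_smul_lt a (b - a) (t₀ := 1) (by simpa)
  have hline : Continuous fun t : K => a + t • (b - a) := by fun_prop
  exact infinite_of_mem_nhds (0 : K)
    (hline.tendsto' 0 a (by simp) (mem_interior_iff_mem_nhds.1 ha)) hfinite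

section Complete

variable (K A : Type*) [NontriviallyNormedField K] [CompleteSpace K] [Ring A] [Algebra K A]
  [Algebra.IsIntegral K A] [TopologicalSpace A] [T2Space A] [IsTopologicalRing A]
  [ContinuousSMul K A]

theorem isClosed_setOfPred_natDegree_minpoly_lt (n : ℕ) :
    IsClosed {a : A | (minpoly K a).natDegree < n} := by
  simp only [← not_le, ← linearIndependent_fin_pow_iff (Algebra.IsIntegral.isIntegral _)]
  have hpow : Continuous fun (a : A) (i : Fin n) => a ^ (i : ℕ) := by fun_prop
  exact (isOpen_setOfPred_linearIndependent_of_t2Space.preimage hpow).isClosed_compl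

theorem bddAbove_range_natDegree_minpoly_of_baireSpace [BaireSpace A] :
    BddAbove (Set.range fun a : A => (minpoly K a).natDegree) := by
  obtain ⟨n, hn⟩ := nonempty_interior_of_iUnion_of_closed
    (isClosed_setOfPred_natDegree_minpoly_lt K A)
    (Set.eq_univ_of_forall fun a => Set.mem_iUnion.2 ⟨_, Nat.lt_succ_self (minpoly K a).natDegree⟩)
  exact ⟨n, Set.forall_mem_range.2 fun a => (natDegree_minpoly_lt_of_nonempty_interior hn a).le⟩

end Complete

end Degree

section DivisionRing

theorem mem_centralizer_of_forall_mul_eq_sum {D ι : Type*} [Ring D] {S : Submonoid D} {v : ι → D}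
    {t : Finset ι} (ht : LinearIndepOn D (fun j (s : S) => (s : D) * v j) t) {w : D} {c : ι → D}
    (hc : ∀ s ∈ S, s * w = ∑ j ∈ t, c j * (s * v j)) {j : ι} (hj : j ∈ t) :
    c j ∈ Set.centralizer (S : Set D) := by
  intro s hs
  -- Evaluate the relation at `s * x` and subtract `s` times the relation at `x`.
  refine sub_eq_zero.1 (linearIndepOn_finset_iff.1 ht (fun j => s * c j - c j * s) ?_ j hj)
  ext ⟨x, hx⟩
  have h := hc (s * x) (S.mul_mem hs hx)
  rw [mul_assoc, hc x hx, Finset.mul_sum] at h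
  simpa [sub_mul, mul_assoc, sub_eq_zero] using h

theorem linearIndependent_mul_of_linearIndependent_centralizer {K D ι : Type*} [CommRing K]
    [DivisionRing D] [Algebra K D] (S : Submonoid D) {v : ι → D}
    (hv : LinearIndependent (Subalgebra.centralizer K (S : Set D)) v) :
    LinearIndependent D fun (j : ι) (s : S) => (s : D) * v j := by
  classical
  suffices h : ∀ t : Finset ι, LinearIndepOn D (fun j (s : S) => (s : D) * v j) t from
    linearIndependent_iff_finset_linearIndependent.2 h
  intro t
  induction t using Finset.induction_on with
  | empty => simp
  | insert i t hit ih =>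
    rw [Finset.coe_insert, linearIndepOn_insert (by simpa)]
    refine ⟨ih, fun hi => hv.notMem_span_image (Finset.mem_coe.not.2 hit) ?_⟩
    obtain ⟨c, hc⟩ := Submodule.mem_span_image_finset_iff_exists_fun' _ |>.1 hi
    have hcS : ∀ s ∈ S, s * v i = ∑ j ∈ t, c j * (s * v j) := fun s hs => by
      simpa using (congr_fun hc ⟨s, hs⟩).symm
    have hv1 : v i = ∑ j ∈ t, c j * v j := by simpa using hcS 1 S.one_mem
    rw [hv1]
    exact Submodule.sum_mem _ fun j hj => Submodule.smul_mem _
      (⟨c j, mem_centralizer_of_forall_mul_eq_sum ih hcS hj⟩ : Subalgebra.centralizer K (S : Set D))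
      (Submodule.subset_span (Set.mem_image_of_mem v hj))

theorem rank_centralizer_le_finrank {K D : Type*} [Field K] [DivisionRing D] [Algebra K D]
    (S : Subalgebra K D) [FiniteDimensional K S] :
    Module.rank (Subalgebra.centralizer K (S : Set D)) D ≤ finrank K S := by
  refine rank_le fun t ht => ?_
  let mulRight (y : t) : S →ₗ[K] D := LinearMap.mulRight K (y : D) ∘ₗ S.val.toLinearMap
  have hli : LinearIndependent D mulRight :=
    (linearIndependent_mul_of_linearIndependent_centralizer S.toSubmonoid ht).of_comp
      (LinearMap.ltoFun K S D D)
  simpa [finrank_linearMap_self] using hli.fintype_card_le_finrank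

theorem finiteDimensional_of_finiteDimensional_centralizer {K D : Type*} [Field K]
    [DivisionRing D] [Algebra K D] (S : Subalgebra K D) [FiniteDimensional K S]
    [FiniteDimensional K (Subalgebra.centralizer K (S : Set D))] :
    FiniteDimensional K D := by
  let C := Subalgebra.centralizer K (S : Set D)
  let : DivisionRing C := divisionRingOfFiniteDimensional K C
  have : Module.Finite C D := rank_lt_aleph0_iff.1
    ((rank_centralizer_le_finrank S).trans_lt Cardinal.natCast_lt_aleph0)
  exact Module.Finite.trans C D

theorem exists_natDegree_minpoly_eq_finrank (K F : Type*) [Field K] [PerfectField K] [CommRing F]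
    [IsDomain F] [Algebra K F] [Module.Finite K F] :
    ∃ z : F, (minpoly K z).natDegree = finrank K F := by
  let : Field F := (isField_of_isIntegral_of_isField' (Field.toIsField K)).toField
  obtain ⟨z, hz⟩ := Field.exists_primitive_element K F
  exact ⟨z, (Field.primitive_element_iff_minpoly_natDegree_eq K z).1 hz⟩

open scoped IsMulCommutative in
theorem finite_adjoin_of_forall_commute {K A : Type*} [CommRing K] [Ring A] [Algebra K A]
    {s : Set A} (hs : s.Finite) (hint : ∀ x ∈ s, IsIntegral K x)
    (hcomm : ∀ x ∈ s, ∀ y ∈ s, x * y = y * x) : Module.Finite K (Algebra.adjoin K s) := by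
  have : IsMulCommutative (Algebra.adjoin K s) := Algebra.isMulCommutative_adjoin K hcomm
  have hfg := fg_adjoin_of_finite (R := K) (A := Algebra.adjoin K s)
    (hs.preimage Subtype.val_injective.injOn) fun x hx =>
      (isIntegral_algHom_iff (Algebra.adjoin K s).val Subtype.val_injective).1 (hint x hx)
  rw [Algebra.adjoin_adjoin_coe_preimage] at hfg
  exact ⟨hfg⟩

theorem minpoly_coe {K A : Type*} [CommRing K] [Ring A] [Algebra K A] {S : Subalgebra K A} (x : S) :
    minpoly K (x : A) = minpoly K x :=
  minpoly.algHom_eq S.val Subtype.val_injective x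

theorem natDegree_minpoly_le_finrank_adjoin {K A : Type*} [Field K] [Ring A] [Algebra K A] {x : A}
    (hx : IsIntegral K x) : (minpoly K x).natDegree ≤ finrank K (Algebra.adjoin K {x}) := by
  have : Module.Finite K (Algebra.adjoin K {x}) := Algebra.finite_adjoin_simple_of_isIntegral hx
  let x' : Algebra.adjoin K {x} := ⟨x, Algebra.self_mem_adjoin_singleton K x⟩
  exact (minpoly_coe x').symm ▸ minpoly.natDegree_le x'

open scoped IsMulCommutative in
theorem mem_adjoin_singleton_of_commute {K D : Type*} [Field K] [PerfectField K] [Ring D]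
    [IsDomain D] [Algebra K D] [Algebra.IsIntegral K D] {x y : D}
    (hx : ∀ a : D, (minpoly K a).natDegree ≤ (minpoly K x).natDegree) (hxy : Commute x y) :
    y ∈ Algebra.adjoin K {x} := by
  have hcomm : ∀ a ∈ ({x, y} : Set D), ∀ b ∈ ({x, y} : Set D), a * b = b * a := by
    simp [hxy.eq]
  have : IsMulCommutative (Algebra.adjoin K {x, y}) := Algebra.isMulCommutative_adjoin K hcomm
  have : FiniteDimensional K (Algebra.adjoin K {x, y}) := finite_adjoin_of_forall_commute
    (Set.toFinite _) (fun a _ => Algebra.IsIntegral.isIntegral a) hcomm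
  obtain ⟨z, hz⟩ := exists_natDegree_minpoly_eq_finrank K (Algebra.adjoin K {x, y})
  have hfinrank : finrank K (Algebra.adjoin K {x, y}) ≤ finrank K (Algebra.adjoin K {x}) :=
    calc finrank K (Algebra.adjoin K {x, y})
      _ = (minpoly K (z : D)).natDegree := by rw [minpoly_coe, hz]
      _ ≤ (minpoly K x).natDegree := hx z
      _ ≤ finrank K (Algebra.adjoin K {x}) :=
        natDegree_minpoly_le_finrank_adjoin (Algebra.IsIntegral.isIntegral x)
  rw [Subalgebra.eq_of_le_of_finrank_le (Algebra.adjoin_mono (by simp)) hfinrank]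
  exact Algebra.subset_adjoin (by simp)

theorem finiteDimensional_of_bddAbove_range_natDegree_minpoly {K D : Type*} [Field K]
    [PerfectField K] [DivisionRing D] [Algebra K D] [Algebra.IsIntegral K D]
    (hbdd : BddAbove (Set.range fun a : D => (minpoly K a).natDegree)) :
    FiniteDimensional K D := by
  obtain ⟨_, ⟨x, rfl⟩, hx⟩ := hbdd.exists_isGreatest_of_nonempty (Set.range_nonempty _)
  have : FiniteDimensional K (Algebra.adjoin K {x}) :=
    Algebra.finite_adjoin_simple_of_isIntegral (Algebra.IsIntegral.isIntegral x)
  have hle : Subalgebra.centralizer K (Algebra.adjoin K {x} : Set D) ≤ Algebra.adjoin K {x} :=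
    fun y hy => mem_adjoin_singleton_of_commute (fun a => hx ⟨a, rfl⟩)
      (hy x (Algebra.self_mem_adjoin_singleton K x))
  have : FiniteDimensional K (Subalgebra.centralizer K (Algebra.adjoin K {x} : Set D)) :=
    FiniteDimensional.of_injective (Subalgebra.inclusion hle).toLinearMap
      (Subalgebra.inclusion_injective hle)
  exact finiteDimensional_of_finiteDimensional_centralizer (Algebra.adjoin K {x})

end DivisionRing

theorem IsFrechetSpace.continuousSMul {K E : Type*} [NormedField K] [AddCommGroup E] [Module K E]
    [UniformSpace E] (hE : IsFrechetSpace K E) : ContinuousSMul K E :=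
  let ⟨_, _, hq⟩ := hE.exists_seminorms
  hq.continuousSMul

theorem IsFrechetSpace.baireSpace {K E : Type*} [NontriviallyNormedField K] [AddCommGroup E]
    [Module K E] [UniformSpace E] (hE : IsFrechetSpace K E) : BaireSpace E := by
  obtain ⟨_, _, hcomplete, q, -, hq⟩ := hE
  have : FirstCountableTopology E := hq.firstCountableTopology
  have : (uniformity E).IsCountablyGenerated := IsUniformAddGroup.uniformity_countably_generated
  infer_instance

theorem IsFrechetAlgebra.isTopologicalRing {K A : Type*} [NormedField K] [Ring A] [Algebra K A]
    [UniformSpace A] (hA : IsFrechetAlgebra K A) : IsTopologicalRing A :=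
  have := hA.isUniformAddGroup
  have := hA.continuousMul
  {}

/-- A normed algebra over a nontrivially normed field, if it is a field, is nontrivially normed.
Its underlying normed field is definitionally the given one. -/
abbrev nontriviallyNormedFieldOfNormedAlgebra (K L : Type*) [NontriviallyNormedField K]
    [NormedField L] [NormedAlgebra K L] : NontriviallyNormedField L where
  non_trivial :=
    let ⟨x, hx⟩ := NormedField.exists_one_lt_norm K
    ⟨algebraMap K L x, by rwa [norm_algebraMap']⟩

theorem mainTheorem3_general (K A : Type*) [NontriviallyNormedField K] [CompleteSpace K]
    [PerfectField K] [DivisionRing A] [Algebra K A] [Algebra.IsAlgebraic K A] [TopologicalSpace A]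
    [T2Space A] [IsTopologicalRing A] [ContinuousSMul K A] [BaireSpace A] :
    FiniteDimensional K A :=
  finiteDimensional_of_bddAbove_range_natDegree_minpoly
    (bddAbove_range_natDegree_minpoly_of_baireSpace K A)

theorem mainTheorem3 (p : ℕ) [Fact p.Prime]
    (L : Type*) [NormedField L] [NormedAlgebra ℚ_[p] L] [FiniteDimensional ℚ_[p] L]
    (A : Type*) [DivisionRing A] [Algebra L A] [UniformSpace A]
    (hA : IsFrechetAlgebra L A)
    (halg : ∀ a : A, IsAlgebraic L a) :
    FiniteDimensional L A := by
  let : NontriviallyNormedField L := nontriviallyNormedFieldOfNormedAlgebra ℚ_[p] L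
  have : CompleteSpace L := FiniteDimensional.complete ℚ_[p] L
  have : CharZero L := charZero_of_injective_algebraMap (algebraMap ℚ_[p] L).injective
  have : Algebra.IsAlgebraic L A := ⟨halg⟩
  have := hA.t2Space
  have := hA.isTopologicalRing
  have := hA.continuousSMul
  have := hA.baireSpace
  exact mainTheorem3_general L A
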